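/- **Theorem 1.7.** Let $1<p\le 2\le q<\infty$ and let $r\in(1,\infty]$ be defined by $1/r=1/p-1/q$ (so $r=\infty$ if $p=q=2$). Then there is a constant $c_{p,q}\in(0,\infty)$, depending only on $p$ and $q$, such that the following holds. Let $X$ be any set and let $a=(a_{ij})_{i,j\in X}$ be a family of complex numbers with $$\|a\|_{\ell_{r,\infty}(X\times X)}:=\sup_{t>0}t^{1/r}\mu_t(a)<\infty,\qquad \mu_t(a):=\inf\bigl\{s>0:\#\{(i,j)\in X\times X:|a_{ij}|>s\}<t\bigr\},$$ where $\inf\emptyset=\infty$ (for $r=\infty$ this is the supremum norm). Identify a bounded operator $x$ on $\ell_2(X)$ with its matrix $(x_{ij})_{i,j\in X}$, $x_{ij}=\langle x e_j,e_i\rangle$, with respect to the standard orthonormal basis $(e_i)_{i\in X}$, and for $0<s<\infty$ let $\mathcal S_s(\ell_2(X))$ be the Schatten class of all bounded operators $x$ on $\ell_2(X)$ with $\|x\|_{\mathcal S_s}:=(\mathrm{Tr}\,|x|^s)^{1/s}<\infty$, where $|x|=(x^*x)^{1/2}$. Then for every $x\in\mathcal S_p(\ell_2(X))$ the matrix $(a_{ij}x_{ij})_{i,j\in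 X}$ is the matrix of a (unique) bounded operator $Ax$ on $\ell_2(X)$, which belongs to $\mathcal S_q(\ell_2(X))$, and $$\|Ax\|_{\mathcal S_q}\le c_{p,q}\,\|a\|_{\ell_{r,\infty}(X\times X)}\,\|x\|_{\mathcal S_p}.$$ In other words, the Schur multiplier $A:(x_{ij})\mapsto(a_{ij}x_{ij})$ is bounded from $\mathcal S_p(\ell_2(X))$ to $\mathcal S_q(\ell_2(X))$ with norm at most $c_{p,q}\|a\|_{\ell_{r,\infty}(X\times X)}$. -/

import Mathlib

open scoped ENNReal lp InnerProductSpace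

noncomputable section

/-- The standard unit vector `e_i` of `ℓ²(X)`. -/
def ell2Basis {X : Type*} (i : X) : ℓ²(X, ℂ) := by
  classical exact lp.single 2 i (1 : ℂ)

/-- The matrix coefficient `x_{ij} = ⟨e_i, x e_j⟩` of a bounded operator `x` on `ℓ²(X)`
(Mathlib's inner product is linear in the second variable). -/
def matrixEntry {X : Type*} (x : ℓ²(X, ℂ) →L[ℂ] ℓ²(X, ℂ)) (i j : X) : ℂ :=
  ⟪ell2Basis i, x (ell2Basis j)⟫_ℂ

/-- A bounded operator on `ℓ²(X)` is determined by its matrix. -/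
theorem ext_matrixEntry {X : Type*} {x y : ℓ²(X, ℂ) →L[ℂ] ℓ²(X, ℂ)}
    (h : ∀ i j, matrixEntry x i j = matrixEntry y i j) : x = y := by
  classical
  have hentry : ∀ (z : ℓ²(X, ℂ) →L[ℂ] ℓ²(X, ℂ)) (i j : X),
      matrixEntry z i j = (z (ell2Basis j) : X → ℂ) i := by
    intro z i j
    simp [matrixEntry, ell2Basis, lp.inner_single_left]
  have hb : ∀ j : X, x (ell2Basis j) = y (ell2Basis j) := by
    intro j
    ext i
    rw [← hentry, ← hentry, h]
  ext1 f
  have hf := lp.hasSum_single (p := 2) (by simp) f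
  have key : ∀ j : X, lp.single 2 j (f j) = (f j) • (ell2Basis j : ℓ²(X, ℂ)) := by
    intro j
    have hs : (ell2Basis j : ℓ²(X, ℂ)) = lp.single 2 j (1 : ℂ) := by
      unfold ell2Basis
      congr
    rw [hs, ← lp.single_smul]
    simp
  have h1 := hf.mapL x
  have h2 := hf.mapL y
  refine h1.unique ?_
  convert h2 using 2 with j
  rw [key, map_smul, map_smul, hb]

/-- The usual trace `Tr T = ∑ᵢ ⟨e_i, T e_i⟩ ∈ [0, ∞]` of a positive bounded operator `T` on
`ℓ²(X)`. It is used for positive `T` only. -/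
def posTrace {X : Type*} (T : ℓ²(X, ℂ) →L[ℂ] ℓ²(X, ℂ)) : ℝ≥0∞ :=
  ∑' i : X, ENNReal.ofReal (matrixEntry T i i).re

/-- The positive operator `|x|^p`, for a bounded operator `x` on a Hilbert space and `p > 0`, where
`|x| = (x* x)^{1/2}`; both powers are given by the continuous functional calculus. -/
def absPow {H : Type*} [NormedAddCommGroup H] [InnerProductSpace ℂ H] [CompleteSpace H]
    (x : H →L[ℂ] H) (p : ℝ) : H →L[ℂ] H :=
  CFC.rpow (CFC.abs x) p

/-- The Schatten norm `‖x‖_p = (Tr |x|^p)^{1/p} ∈ [0, ∞]`, for `0 < p < ∞`. -/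
def schattenNorm {X : Type*} (p : ℝ) (x : ℓ²(X, ℂ) →L[ℂ] ℓ²(X, ℂ)) : ℝ≥0∞ :=
  posTrace (absPow x p) ^ (1 / p)

/-- The Schatten class `S_p(ℓ²(X)) = L_p(B(ℓ²(X)), Tr)`, for `0 < p < ∞`. -/
def schattenClass (X : Type*) (p : ℝ) : Set (ℓ²(X, ℂ) →L[ℂ] ℓ²(X, ℂ)) :=
  {x | schattenNorm p x < ∞}

/-- The distribution function `λ_s(f) = #{i : |f i| > s}` of `f : ι → ℂ`, with respect to the
counting measure on `ι`. -/
def distribution {ι : Type*} (f : ι → ℂ) (s : ℝ≥0∞) : ℝ≥0∞ :=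
  ((Set.encard {i | s < ‖f i‖ₑ} : ℕ∞) : ℝ≥0∞)

/-- The (generalized) singular numbers, i.e. the decreasing rearrangement,
`μ_t(f) = inf {s > 0 : λ_s(f) < t}` of `f : ι → ℂ`; it is `∞` if no finite `s` qualifies. -/
def rearrangement {ι : Type*} (f : ι → ℂ) (t : ℝ) : ℝ≥0∞ :=
  sInf {s : ℝ≥0∞ | 0 < s ∧ distribution f s < ENNReal.ofReal t}

/-- The quasi-norm `‖f‖_{r,∞} = sup_{t > 0} t^{1/r} μ_t(f) ∈ [0, ∞]` of the weak space
`ℓ_{r,∞}(ι)`, for `0 < r ≤ ∞`; for `r = ∞` this is the supremum norm. -/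
def weakNorm {ι : Type*} (r : ℝ≥0∞) (f : ι → ℂ) : ℝ≥0∞ :=
  ⨆ (t : ℝ) (_ : 0 < t), ENNReal.ofReal t ^ (r⁻¹).toReal * rearrangement f t

/-- `y` is the image of `x` under the Schur multiplier with symbol `a`, i.e. the matrix of `y` is
`(a_{ij} x_{ij})`. There is at most one such bounded operator `y`, as an operator is determined by
its matrix. -/
def IsSchurImage {X : Type*} (a : X × X → ℂ) (x y : ℓ²(X, ℂ) →L[ℂ] ℓ²(X, ℂ)) : Prop :=
  ∀ i j : X, matrixEntry y i j = a (i, j) * matrixEntry x i j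

end

open scoped NNReal

namespace SchattenSchur

/-! ### Powers of the modulus of an operator -/

section HilbertSpace

variable {H : Type*} [NormedAddCommGroup H] [InnerProductSpace ℂ H]

/-! The multiplier factors through the Hilbert–Schmidt class, and the constant 1 works. Points have
counting measure 1, so the weak norm dominates the supremum norm (`enorm_apply_le_weakNorm`). The
Hilbert–Schmidt norm is the `ℓ²` norm of the matrix (`schattenNorm_two_sq`), so a symbol bounded by
`M` maps `S_2` to itself with norm at most `M`. Since `p ≤ 2 ≤ q`, the contractive inclusions of
`S_p` in `S_2` and of `S_2` in `S_q` (`schattenNorm_anti`) do the rest. -/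

theorem enorm_inner_sq_le (u f : H) :
    ‖⟪u, f⟫_ℂ‖ₑ ^ 2 ≤ ‖u‖ₑ ^ 2 * ‖f‖ₑ ^ 2 := by
  rw [← mul_pow, ← ofReal_norm, ← ofReal_norm u, ← ofReal_norm f,
    ← ENNReal.ofReal_mul (norm_nonneg _)]
  gcongr
  exact norm_inner_le_norm u f

variable [CompleteSpace H]

theorem exists_star_mul_self_eq {T : H →L[ℂ] H} (hT : 0 ≤ T) :
    ∃ S : H →L[ℂ] H, star S * S = T ∧ ‖T‖ = ‖S‖ ^ 2 := by
  have h : star (CFC.sqrt T) * CFC.sqrt T = T := by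
    rw [(IsSelfAdjoint.of_nonneg (CFC.sqrt_nonneg T)).star_eq, CFC.sqrt_mul_sqrt_self T hT]
  refine ⟨CFC.sqrt T, h, ?_⟩
  rw [sq, ← CStarRing.norm_star_mul_self, h]

theorem absPow_nonneg (x : H →L[ℂ] H) (p : ℝ) : 0 ≤ absPow x p :=
  CFC.rpow_nonneg

theorem absPow_two (x : H →L[ℂ] H) : absPow x 2 = star x * x := by
  rw [absPow, CFC.rpow_eq_pow, ← CFC.abs_sq, ← CFC.rpow_natCast _ 2 (CFC.abs_nonneg x)]
  norm_num

/-- The spectrum of `|x|` lies in `[0, ‖x‖]`, where `t ^ q ≤ ‖x‖ ^ (q - p) * t ^ p`; the functional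
calculus preserves this inequality. -/
theorem absPow_le_smul_absPow (x : H →L[ℂ] H) {p q : ℝ} (hp : 0 < p) (hpq : p ≤ q) :
    absPow x q ≤ (‖x‖₊ ^ (q - p)) • absPow x p := by
  cases subsingleton_or_nontrivial (H →L[ℂ] H) with
  | inl _ => exact (Subsingleton.elim _ _).le
  | inr _ =>
    have : Nontrivial H := by
      by_contra hn
      rw [not_nontrivial_iff_subsingleton] at hn
      exact not_subsingleton (H →L[ℂ] H) inferInstance
    have hc : ∀ {s : ℝ}, 0 < s → ContinuousOn (fun t : ℝ≥0 => t ^ s)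
        (spectrum ℝ≥0 (CFC.abs x)) := fun hs =>
      (NNReal.continuous_rpow_const hs.le).continuousOn
    have hq : 0 < q := hp.trans_le hpq
    rw [absPow, absPow, CFC.rpow_eq_pow, CFC.rpow_eq_pow, CFC.rpow_def, CFC.rpow_def,
      ← cfc_smul _ _ _ (hc hp)]
    refine cfc_mono (fun t ht => ?_) (hc hq) (continuousOn_const.mul (hc hp))
    have htx : t ≤ ‖x‖₊ := by
      have := spectrum.le_nnnorm_of_mem ht
      rwa [← NNReal.coe_le_coe, coe_nnnorm, CFC.norm_abs] at this
    calc t ^ q = t ^ (q - p) * t ^ p := by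
          rw [← NNReal.rpow_add_of_nonneg _ (sub_nonneg.2 hpq) hp.le, sub_add_cancel]
      _ ≤ ‖x‖₊ ^ (q - p) * t ^ p := by
          gcongr

theorem enorm_absPow (x : H →L[ℂ] H) {p : ℝ} (hp : 0 < p) : ‖absPow x p‖ₑ = ‖x‖ₑ ^ p := by
  rw [absPow, CFC.rpow_eq_pow, ← ofReal_norm, CFC.norm_rpow _ hp (CFC.abs_nonneg x),
    CFC.norm_abs, ← ENNReal.ofReal_rpow_of_nonneg (norm_nonneg _) hp.le, ofReal_norm]

end HilbertSpace

/-! ### Traces, matrices and Schatten norms -/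

variable {X : Type*}

theorem matrixEntry_eq_apply (x : ℓ²(X, ℂ) →L[ℂ] ℓ²(X, ℂ)) (i j : X) :
    matrixEntry x i j = (x (ell2Basis j) : X → ℂ) i := by
  classical
  simp [matrixEntry, ell2Basis, lp.inner_single_left]

theorem inner_ell2Basis_left (i : X) (f : ℓ²(X, ℂ)) : ⟪ell2Basis i, f⟫_ℂ = f i := by
  classical
  simp [ell2Basis, lp.inner_single_left]

theorem memℓp_two_iff_tsum_enorm_sq_ne_top {f : X → ℂ} :
    Memℓp f 2 ↔ ∑' i, ‖f i‖ₑ ^ 2 ≠ ∞ := by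
  rw [memℓp_gen_iff (by norm_num)]
  have h : ∀ i, ‖f i‖ₑ ^ 2 = ((‖f i‖₊ ^ 2 : ℝ≥0) : ℝ≥0∞) := fun i => by
    simp [enorm_eq_nnnorm]
  simp_rw [h]
  rw [ENNReal.tsum_coe_ne_top_iff_summable, ← NNReal.summable_coe]
  simp

/-- Parseval's identity in `ℓ²(X)`. -/
theorem enorm_sq_eq_tsum (f : ℓ²(X, ℂ)) : ‖f‖ₑ ^ 2 = ∑' i, ‖f i‖ₑ ^ 2 := by
  have h := lp.hasSum_norm (p := 2) (by norm_num) f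
  simp only [ENNReal.toReal_ofNat, Real.rpow_ofNat] at h
  have e : ∀ {E : Type _} [NormedAddCommGroup E] (z : E), ‖z‖ₑ ^ 2 = ENNReal.ofReal (‖z‖ ^ 2) :=
    fun z => by rw [ENNReal.ofReal_pow (norm_nonneg _), ofReal_norm]
  rw [e, ← h.tsum_eq, ENNReal.ofReal_tsum_of_nonneg (fun _ => by positivity) h.summable]
  refine tsum_congr fun i => ?_
  rw [ENNReal.ofReal_pow (norm_nonneg _), ofReal_norm]

theorem posTrace_star_mul_self (S : ℓ²(X, ℂ) →L[ℂ] ℓ²(X, ℂ)) :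
    posTrace (star S * S) = ∑' j, ‖S (ell2Basis j)‖ₑ ^ 2 := by
  refine tsum_congr fun j => ?_
  have h : matrixEntry (star S * S) j j = ⟪S (ell2Basis j), S (ell2Basis j)⟫_ℂ := by
    rw [matrixEntry, ContinuousLinearMap.star_eq_adjoint, mul_apply_eq_comp,
      ContinuousLinearMap.adjoint_inner_right]
  rw [h, inner_self_eq_norm_sq_to_K, ← ofReal_norm, ← ENNReal.ofReal_pow (norm_nonneg _)]
  norm_cast

theorem posTrace_star_mul_self_eq_tsum (S : ℓ²(X, ℂ) →L[ℂ] ℓ²(X, ℂ)) :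
    posTrace (star S * S) = ∑' (i) (j), ‖matrixEntry S i j‖ₑ ^ 2 := by
  rw [posTrace_star_mul_self, ENNReal.tsum_comm]
  exact tsum_congr fun j => by simp_rw [enorm_sq_eq_tsum, matrixEntry_eq_apply]

theorem star_apply_ell2Basis (S : ℓ²(X, ℂ) →L[ℂ] ℓ²(X, ℂ)) (i j : X) :
    (star S (ell2Basis i) : X → ℂ) j = star (matrixEntry S i j) := by
  rw [← inner_ell2Basis_left, ContinuousLinearMap.star_eq_adjoint,
    ContinuousLinearMap.adjoint_inner_right, matrixEntry, RCLike.star_def, inner_conj_symm]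

theorem tsum_enorm_star_apply_sq (S : ℓ²(X, ℂ) →L[ℂ] ℓ²(X, ℂ)) :
    ∑' i, ‖star S (ell2Basis i)‖ₑ ^ 2 = posTrace (star S * S) := by
  rw [posTrace_star_mul_self_eq_tsum]
  refine tsum_congr fun i => ?_
  rw [enorm_sq_eq_tsum]
  exact tsum_congr fun j => by simp_rw [star_apply_ell2Basis, enorm_eq_nnnorm, nnnorm_star]

/-- Cauchy–Schwarz in each row: `(S f) i = ⟪S* e_i, f⟫`, and the squared norms of the rows `S* e_i`
sum to the trace. -/
theorem enorm_sq_le_posTrace_star_mul_self (S : ℓ²(X, ℂ) →L[ℂ] ℓ²(X, ℂ)) :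
    ‖S‖ₑ ^ 2 ≤ posTrace (star S * S) := by
  have key : ‖S‖ₑ ≤ posTrace (star S * S) ^ (1 / 2 : ℝ) := by
    refine S.opENorm_le_bound fun f => ?_
    have h : ‖S f‖ₑ ^ 2 ≤ posTrace (star S * S) * ‖f‖ₑ ^ 2 := by
      rw [enorm_sq_eq_tsum, ← tsum_enorm_star_apply_sq, ← ENNReal.tsum_mul_right]
      refine ENNReal.tsum_le_tsum fun i => ?_
      have : (S f : X → ℂ) i = ⟪star S (ell2Basis i), f⟫_ℂ := by
        rw [← inner_ell2Basis_left, ContinuousLinearMap.star_eq_adjoint,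
          ContinuousLinearMap.adjoint_inner_left]
      rw [this]
      exact enorm_inner_sq_le _ _
    have h' := ENNReal.rpow_le_rpow h (by norm_num : (0 : ℝ) ≤ 1 / 2)
    rwa [ENNReal.mul_rpow_of_nonneg _ _ (by norm_num), ← ENNReal.rpow_natCast,
      ← ENNReal.rpow_natCast, ← ENNReal.rpow_mul, ← ENNReal.rpow_mul, Nat.cast_ofNat,
      mul_one_div_cancel two_ne_zero, ENNReal.rpow_one, ENNReal.rpow_one] at h'
  calc ‖S‖ₑ ^ 2 ≤ (posTrace (star S * S) ^ (1 / 2 : ℝ)) ^ 2 := by gcongr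
    _ = posTrace (star S * S) := by
      rw [← ENNReal.rpow_natCast, ← ENNReal.rpow_mul, Nat.cast_ofNat,
        one_div_mul_cancel two_ne_zero, ENNReal.rpow_one]

/-- The operator norm of a positive operator is at most its trace. -/
theorem enorm_le_posTrace {T : ℓ²(X, ℂ) →L[ℂ] ℓ²(X, ℂ)} (hT : 0 ≤ T) : ‖T‖ₑ ≤ posTrace T := by
  obtain ⟨S, rfl, hS⟩ := exists_star_mul_self_eq hT
  refine le_trans (le_of_eq ?_) (enorm_sq_le_posTrace_star_mul_self S)
  rw [← ofReal_norm, ← ofReal_norm, ← ENNReal.ofReal_pow (norm_nonneg _), hS]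

theorem posTrace_mono {S T : ℓ²(X, ℂ) →L[ℂ] ℓ²(X, ℂ)} (h : S ≤ T) : posTrace S ≤ posTrace T := by
  refine ENNReal.tsum_le_tsum fun i => ENNReal.ofReal_le_ofReal ?_
  have := ((ContinuousLinearMap.le_def S T).1 h).re_inner_nonneg_right (ell2Basis i)
  rw [sub_apply, inner_sub_right, map_sub] at this
  exact sub_nonneg.1 this

theorem posTrace_smul (c : ℝ≥0) (T : ℓ²(X, ℂ) →L[ℂ] ℓ²(X, ℂ)) :
    posTrace (c • T) = c * posTrace T := by
  rw [posTrace, posTrace, ← ENNReal.tsum_mul_left]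
  refine tsum_congr fun i => ?_
  have : matrixEntry (c • T) i i = (c : ℝ) * matrixEntry T i i := by
    rw [matrixEntry_eq_apply, matrixEntry_eq_apply]
    rfl
  rw [this, Complex.re_ofReal_mul, ENNReal.ofReal_mul c.coe_nonneg, ENNReal.ofReal_coe_nnreal]

theorem enorm_le_schattenNorm (x : ℓ²(X, ℂ) →L[ℂ] ℓ²(X, ℂ)) {p : ℝ} (hp : 0 < p) :
    ‖x‖ₑ ≤ schattenNorm p x := by
  have h := enorm_le_posTrace (absPow_nonneg x p)
  rw [enorm_absPow x hp] at h
  have h' := ENNReal.rpow_le_rpow h (one_div_nonneg.2 hp.le)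
  rwa [← ENNReal.rpow_mul, mul_one_div_cancel hp.ne', ENNReal.rpow_one] at h'

theorem schattenNorm_rpow (x : ℓ²(X, ℂ) →L[ℂ] ℓ²(X, ℂ)) {p : ℝ} (hp : 0 < p) :
    schattenNorm p x ^ p = posTrace (absPow x p) := by
  rw [schattenNorm, ← ENNReal.rpow_mul, one_div_mul_cancel hp.ne', ENNReal.rpow_one]

/-- The Schatten norms decrease in the exponent. -/
theorem schattenNorm_anti (x : ℓ²(X, ℂ) →L[ℂ] ℓ²(X, ℂ)) {p q : ℝ} (hp : 0 < p) (hpq : p ≤ q) :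
    schattenNorm q x ≤ schattenNorm p x := by
  have hq : 0 < q := hp.trans_le hpq
  rw [← ENNReal.rpow_le_rpow_iff hq, schattenNorm_rpow x hq]
  calc posTrace (absPow x q)
      ≤ posTrace ((‖x‖₊ ^ (q - p)) • absPow x p) := posTrace_mono (absPow_le_smul_absPow x hp hpq)
    _ = ‖x‖ₑ ^ (q - p) * schattenNorm p x ^ p := by
        rw [posTrace_smul, schattenNorm_rpow x hp, enorm_eq_nnnorm,
          ENNReal.coe_rpow_of_nonneg _ (sub_nonneg.2 hpq)]
    -- The operator norm is at most the Schatten norm, so the excess power is absorbed with constant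
    -- 1.
    _ ≤ schattenNorm p x ^ (q - p) * schattenNorm p x ^ p := by
        exact mul_le_mul_left
          (ENNReal.rpow_le_rpow (enorm_le_schattenNorm x hp) (sub_nonneg.2 hpq)) _
    _ = schattenNorm p x ^ q := by
        rw [← ENNReal.rpow_add_of_nonneg _ _ (sub_nonneg.2 hpq) hp.le, sub_add_cancel]

/-- The Hilbert–Schmidt norm is the `ℓ²` norm of the matrix. -/
theorem schattenNorm_two_sq (x : ℓ²(X, ℂ) →L[ℂ] ℓ²(X, ℂ)) :
    schattenNorm 2 x ^ 2 = ∑' (i) (j), ‖matrixEntry x i j‖ₑ ^ 2 := by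
  rw [← posTrace_star_mul_self_eq_tsum, ← absPow_two, ← schattenNorm_rpow x two_pos,
    ENNReal.rpow_ofNat]

/-- The weak norm dominates the supremum norm on a discrete space. -/
theorem enorm_apply_le_weakNorm {ι : Type*} (r : ℝ≥0∞) (f : ι → ℂ) (i : ι) :
    ‖f i‖ₑ ≤ weakNorm r f := by
  -- At `t = 1` an admissible `s` has fewer than one point above it, hence none.
  have h : ‖f i‖ₑ ≤ rearrangement f 1 := by
    refine le_sInf fun s hs => ?_
    by_contra! hlt
    have hd := hs.2
    have hne : (1 : ℕ∞) ≤ Set.encard {i | s < ‖f i‖ₑ} :=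
      Set.one_le_encard_iff_nonempty.2 ⟨i, hlt⟩
    rw [distribution, ENNReal.ofReal_one] at hd
    exact hd.not_ge (by exact_mod_cast hne)
  refine h.trans ?_
  refine le_trans (le_of_eq ?_) (le_iSup₂ (1 : ℝ) one_pos)
  simp

/-- A square summable family of rows is the family of rows of a bounded operator. -/
theorem exists_clm_of_rows (u : X → ℓ²(X, ℂ)) (hu : ∑' i, ‖u i‖ₑ ^ 2 ≠ ∞) :
    ∃ y : ℓ²(X, ℂ) →L[ℂ] ℓ²(X, ℂ), ∀ f i, (y f : X → ℂ) i = ⟪u i, f⟫_ℂ := by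
  have hle : ∀ f : ℓ²(X, ℂ), ∑' i, ‖⟪u i, f⟫_ℂ‖ₑ ^ 2 ≤ (∑' i, ‖u i‖ₑ ^ 2) * ‖f‖ₑ ^ 2 := fun f => by
    rw [← ENNReal.tsum_mul_right]
    exact ENNReal.tsum_le_tsum fun i => enorm_inner_sq_le _ _
  have hmem : ∀ f : ℓ²(X, ℂ), Memℓp (fun i => ⟪u i, f⟫_ℂ) 2 := fun f =>
    memℓp_two_iff_tsum_enorm_sq_ne_top.2
      ((hle f).trans_lt (ENNReal.mul_lt_top hu.lt_top (by simp))).ne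
  let L : ℓ²(X, ℂ) →ₗ[ℂ] ℓ²(X, ℂ) :=
    { toFun := fun f => ⟨fun i => ⟪u i, f⟫_ℂ, hmem f⟩
      map_add' := fun f g => by ext i; exact inner_add_right _ _ _
      map_smul' := fun c f => by ext i; exact inner_smul_right _ _ _ }
  -- The bound is the Hilbert–Schmidt norm, again by Cauchy–Schwarz in each row.
  refine ⟨L.mkContinuous (√(∑' i, ‖u i‖ₑ ^ 2).toReal) fun f => ?_, fun f i => rfl⟩
  have h := hle f
  have e : ‖L f‖ₑ ^ 2 = ∑' i, ‖⟪u i, f⟫_ℂ‖ₑ ^ 2 := enorm_sq_eq_tsum (L f)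
  rw [← e] at h
  have h' := ENNReal.toReal_mono (ENNReal.mul_ne_top hu (by simp)) h
  simp only [ENNReal.toReal_mul, ENNReal.toReal_pow, toReal_enorm] at h'
  refine le_of_sq_le_sq ?_ (by positivity)
  rwa [mul_pow, Real.sq_sqrt ENNReal.toReal_nonneg]

/-- A bounded symbol acts on the Hilbert–Schmidt class as a Schur multiplier. -/
theorem exists_isSchurImage {a : X × X → ℂ} {M : ℝ≥0∞} (hM : M ≠ ∞) (ha : ∀ k, ‖a k‖ₑ ≤ M)
    {x : ℓ²(X, ℂ) →L[ℂ] ℓ²(X, ℂ)} (hx : schattenNorm 2 x ≠ ∞) :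
    ∃ y : ℓ²(X, ℂ) →L[ℂ] ℓ²(X, ℂ), IsSchurImage a x y := by
  have hrow : ∀ i, ∑' j, ‖star (a (i, j) * matrixEntry x i j)‖ₑ ^ 2 ≤
      M ^ 2 * ∑' j, ‖matrixEntry x i j‖ₑ ^ 2 := fun i => by
    rw [← ENNReal.tsum_mul_left]
    refine ENNReal.tsum_le_tsum fun j => ?_
    rw [enorm_eq_nnnorm, nnnorm_star, ← enorm_eq_nnnorm, enorm_mul, mul_pow]
    gcongr
    exact ha _
  have hsum : M ^ 2 * ∑' (i) (j), ‖matrixEntry x i j‖ₑ ^ 2 < ∞ := by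
    rw [← schattenNorm_two_sq]
    exact ENNReal.mul_lt_top (ENNReal.pow_lt_top hM.lt_top) (ENNReal.pow_lt_top hx.lt_top)
  rw [← ENNReal.tsum_mul_left] at hsum
  have hmem : ∀ i, Memℓp (fun j => star (a (i, j) * matrixEntry x i j)) 2 := fun i =>
    memℓp_two_iff_tsum_enorm_sq_ne_top.2
      (((hrow i).trans (ENNReal.le_tsum i)).trans_lt hsum).ne
  -- The rows are conjugated because the inner product is conjugate-linear in its first variable.
  let u : X → ℓ²(X, ℂ) := fun i => ⟨_, hmem i⟩
  have hu : ∑' i, ‖u i‖ₑ ^ 2 ≠ ∞ := by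
    refine ((ENNReal.tsum_le_tsum fun i => ?_).trans_lt hsum).ne
    rw [enorm_sq_eq_tsum]
    exact hrow i
  obtain ⟨y, hy⟩ := exists_clm_of_rows u hu
  refine ⟨y, fun i j => ?_⟩
  rw [matrixEntry_eq_apply, hy, ← inner_conj_symm, inner_ell2Basis_left]
  exact star_star _

theorem schattenNorm_two_le_of_isSchurImage {a : X × X → ℂ} {M : ℝ≥0∞} (ha : ∀ k, ‖a k‖ₑ ≤ M)
    {x y : ℓ²(X, ℂ) →L[ℂ] ℓ²(X, ℂ)} (h : IsSchurImage a x y) :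
    schattenNorm 2 y ≤ M * schattenNorm 2 x := by
  rw [← ENNReal.pow_le_pow_left_iff two_ne_zero, mul_pow, schattenNorm_two_sq, schattenNorm_two_sq]
  simp_rw [← ENNReal.tsum_mul_left]
  refine ENNReal.tsum_le_tsum fun i => ENNReal.tsum_le_tsum fun j => ?_
  rw [h i j, enorm_mul, mul_pow]
  gcongr
  exact ha _

end SchattenSchur

open SchattenSchur

theorem theorem1p7 (p q : ℝ) (r : ℝ≥0∞) (hp : 1 < p) (hp2 : p ≤ 2) (hq2 : 2 ≤ q)
    (hr : r⁻¹ = ENNReal.ofReal (1 / p - 1 / q)) :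
    ∃ c : ℝ, 0 < c ∧ ∀ (X : Type*) (a : X × X → ℂ), weakNorm r a < ∞ →
      ∀ x ∈ schattenClass X p, ∃! y : ℓ²(X, ℂ) →L[ℂ] ℓ²(X, ℂ),
        IsSchurImage a x y ∧ y ∈ schattenClass X q ∧
          schattenNorm q y ≤ ENNReal.ofReal c * weakNorm r a * schattenNorm p x := by
  refine ⟨1, one_pos, fun X a ha x hx => ?_⟩
  have hsup := enorm_apply_le_weakNorm r a
  have hx2 : schattenNorm 2 x ≤ schattenNorm p x := schattenNorm_anti x (by linarith) hp2
  obtain ⟨y, hy⟩ := exists_isSchurImage ha.ne hsup (hx2.trans_lt hx).ne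
  have hyq : schattenNorm q y ≤ weakNorm r a * schattenNorm p x :=
    calc schattenNorm q y ≤ schattenNorm 2 y := schattenNorm_anti y two_pos hq2
      _ ≤ weakNorm r a * schattenNorm 2 x := schattenNorm_two_le_of_isSchurImage hsup hy
      _ ≤ weakNorm r a * schattenNorm p x := by gcongr
  refine ⟨y, ⟨hy, hyq.trans_lt (ENNReal.mul_lt_top ha hx), ?_⟩, fun z hz => ?_⟩
  · rwa [ENNReal.ofReal_one, one_mul]
  · exact ext_matrixEntry fun i j => (hz.1 i j).trans (hy i j).symm
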